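/- Let $G$ be a block graph, i.e. a finite simple connected graph all of whose blocks (maximal connected subgraphs without cut vertex) are cliques, and let $n$ be its order. Write $D(u,v)$ for the detour distance (the length of a longest $u$–$v$ path) and $\mathcal D=\max_{u,v}D(u,v)$ for the detour diameter. Let $C$ be the set of detour central vertices, i.e. the vertices $v$ for which $\max_u D(v,u)$ is minimum, let $\omega=|C|$, $\mathcal L(u)=\min_{w\in C}D(w,u)$ and $\mathcal L(G)=\sum_{u}\mathcal L(u)$. A block attached to $w\in C$ is a block containing $w$ whose vertex set is not $C$. If $\omega=1$, let $\xi$ be the minimum of $|V(B)|-1$ over the blocks $B$ attached to the detour central vertex ($\xi=0$ if $n=1$); otherwise let $\xi=0$. The branch induced by a block $B$ attached to $w\in C$ consists of the vertices of $B$ and all vertices $v$ such that the shortest path from the detour central vertex nearest to $v$ to $v$ contains a vertex of $V(B)\setminus C$. Two vertices are in different branches if they lie in the branches induced by two different blocks attached to the same detour central vertex; they are in opposite branches if they lie in branches at two different detour central vertices, where a detour central vertex with no attached block counts as a branch at itself. A hamiltonian coloring of $G$ is a map $c:V(G)\to\{0,1,2,\dots\}$ with $D(u,v)+|c(u)-c(v)|\ge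 n-1$ for all distinct $u,v$; $hc(G)$ is the minimum over all hamiltonian colorings $c$ of $\max_v c(v)$, and $c$ is optimal if it attains this minimum. Suppose that $\mathcal D\le n/2$ and that there is an ordering $u_0,u_1,\dots,u_{n-1}$ of the vertices of $G$ such that (a) $\mathcal L(u_0)=0$ and $\mathcal L(u_{n-1})=\xi$ if $\omega=1$, and $\mathcal L(u_0)=\mathcal L(u_{n-1})=0$ if $\omega\ge 2$; (b) for $0\le i\le n-2$, $u_i$ and $u_{i+1}$ are in different branches if $\omega=1$, and in opposite branches if $\omega\ge2$. Then $$hc(G)=(n-1)(n-\omega)-2\mathcal L(G)+\xi .$$ Moreover, the mapping $c$ defined by $c(u_0)=0$ and $c(u_{i+1})=c(u_i)+n-\omega-\mathcal L(u_{i+1})-\mathcal L(u_i)$ for $0\le i\le n-2$ is an optimal hamiltonian coloring of $G$, and for $n\ge3$ it satisfies $0=c(u_0)<c(u_1)<\dots<c(u_{n-1})$. In particular, call $G$ star shaped if it has an ordering of its vertices satisfying (a) and (b), and an $SDB(n/2)$ block graph if moreover $\mathcal D\le n/2$; then $hc(G)=(n-1)(n-\omega)-2\mathcal L(G)+\xi$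 for every $SDB(n/2)$ block graph $G$. -/

import Mathlib

namespace SimpleGraph

variable {V : Type*}

/-! ### Detour distance -/

/-- The detour distance `D(u, v)`: the length of a longest `u`-`v` path. (In a finite connected
graph the set of lengths is nonempty and bounded, so this supremum is a maximum.) -/
noncomputable def detourDist (G : SimpleGraph V) (u v : V) : ℕ :=
  sSup {l : ℕ | ∃ p : G.Walk u v, p.IsPath ∧ p.length = l}

/-- The detour diameter: the maximum of `D(u, v)` over all pairs of vertices. -/
noncomputable def detourDiam [Fintype V] (G : SimpleGraph V) : ℕ :=
  Finset.univ.sup fun p : V × V => G.detourDist p.1 p.2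

/-- The detour eccentricity of `v`: the detour distance to a vertex farthest from `v`. -/
noncomputable def detourEcc [Fintype V] (G : SimpleGraph V) (v : V) : ℕ :=
  Finset.univ.sup fun u : V => G.detourDist v u

/-- The vertex set of the detour center: the vertices of minimum detour eccentricity. -/
def detourCenter [Fintype V] (G : SimpleGraph V) : Set V :=
  {v | ∀ u, G.detourEcc v ≤ G.detourEcc u}

/-- `ω`, the number of detour central vertices. -/
noncomputable def detourOmega [Fintype V] (G : SimpleGraph V) : ℕ :=
  G.detourCenter.ncard

/-- The detour level `ℒ(u)`: the minimum of `D(w, u)` over the detour central vertices `w`. -/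
noncomputable def detourLevel [Fintype V] (G : SimpleGraph V) (u : V) : ℕ :=
  sInf {l : ℕ | ∃ w ∈ G.detourCenter, G.detourDist w u = l}

/-- The total detour level `ℒ(G)`. -/
noncomputable def totalDetourLevel [Fintype V] (G : SimpleGraph V) : ℕ :=
  ∑ u : V, G.detourLevel u

/-! ### Blocks and block graphs -/

/-- The subgraph induced on `B` is connected and has no cut vertex: deleting any of its vertices
leaves at most one component. -/
def IsNonseparable (G : SimpleGraph V) (B : Set V) : Prop :=
  (G.induce B).Connected ∧ ∀ v ∈ B, (G.induce (B \ {v})).Preconnected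

/-- `B` is the vertex set of a block: a maximal connected subgraph without a cut vertex.
(Such a maximal subgraph is an induced one, so it is given by its vertex set.) -/
def IsBlock (G : SimpleGraph V) (B : Set V) : Prop :=
  Maximal G.IsNonseparable B

/-- A block graph: a connected graph all of whose blocks are cliques. -/
def IsBlockGraph (G : SimpleGraph V) : Prop :=
  G.Connected ∧ ∀ B : Set V, G.IsBlock B → G.IsClique B

/-! ### Branches -/

/-- `B` is a block attached to the detour central vertex `w`. When there are several detour
central vertices they form a block themselves; that block is not one of the attached blocks. -/
def IsAttachedBlock [Fintype V] (G : SimpleGraph V) (w : V) (B : Set V) : Prop :=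
  w ∈ G.detourCenter ∧ G.IsBlock B ∧ w ∈ B ∧ B ≠ G.detourCenter

/-- `ξ`: the minimum of `|V(B)| - 1` over the blocks `B` attached to the detour central vertex
if there is only one such vertex, and `0` otherwise. -/
noncomputable def detourXi [Fintype V] (G : SimpleGraph V) : ℕ :=
  open Classical in
  if G.detourOmega = 1 then sInf {k : ℕ | ∃ w B, G.IsAttachedBlock w B ∧ B.ncard - 1 = k}
  else 0

/-- `x` is an ancestor of `v`: it lies on the (shortest) path from the nearest detour central
vertex `w` to `v`. -/
def IsDetourAncestor [Fintype V] (G : SimpleGraph V) (x v : V) : Prop :=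
  ∃ w ∈ G.detourCenter, G.detourDist w v = G.detourLevel v ∧
    G.dist w x + G.dist x v = G.dist w v

/-- The vertex set of the branch induced by a block `B` attached to a detour central vertex:
the vertices of `B` and the descendants of the non-central vertices of `B`. -/
def detourBranch [Fintype V] (G : SimpleGraph V) (B : Set V) : Set V :=
  B ∪ {v | ∃ x ∈ B, x ∉ G.detourCenter ∧ G.IsDetourAncestor x v}

/-- `u` and `v` are in different branches, that is, in the branches induced by two different
blocks attached to the same detour central vertex (which itself lies in all of these branches). -/
def InDifferentBranches [Fintype V] (G : SimpleGraph V) (u v : V) : Prop :=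
  ∃ w B B', G.IsAttachedBlock w B ∧ G.IsAttachedBlock w B' ∧ B ≠ B' ∧
    u ∈ G.detourBranch B ∧ v ∈ G.detourBranch B'

/-- The detour central vertex `w` together with all the branches at `w`. -/
def detourSide [Fintype V] (G : SimpleGraph V) (w : V) : Set V :=
  {v | v = w ∨ ∃ B, G.IsAttachedBlock w B ∧ v ∈ G.detourBranch B}

/-- `u` and `v` are in opposite branches, that is, in branches at two different detour central
vertices. A detour central vertex to which no block is attached counts as a trivial branch. -/
def InOppositeBranches [Fintype V] (G : SimpleGraph V) (u v : V) : Prop :=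
  ∃ w ∈ G.detourCenter, ∃ w' ∈ G.detourCenter, w ≠ w' ∧
    u ∈ G.detourSide w ∧ v ∈ G.detourSide w'

/-! ### Hamiltonian colorings -/

/-- A hamiltonian coloring: `D(u, v) + |c(u) - c(v)| ≥ n - 1` for all distinct `u`, `v`. -/
def IsHamiltonianColoring [Fintype V] (G : SimpleGraph V) (c : V → ℕ) : Prop :=
  ∀ u v : V, u ≠ v →
    (Fintype.card V : ℤ) - 1 ≤ (G.detourDist u v : ℤ) + |(c u : ℤ) - (c v : ℤ)|

/-- The value `hc(c)` of a coloring: the maximum color assigned to a vertex. -/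
def coloringValue [Fintype V] (c : V → ℕ) : ℕ :=
  Finset.univ.sup c

/-- The hamiltonian chromatic number `hc(G)`: the minimum of `hc(c)` over all hamiltonian
colorings `c` of `G`. -/
noncomputable def hamiltonianChromaticNumber [Fintype V] (G : SimpleGraph V) : ℕ :=
  sInf {k : ℕ | ∃ c : V → ℕ, G.IsHamiltonianColoring c ∧ coloringValue c = k}

/-- An optimal hamiltonian coloring. -/
def IsOptimalHamiltonianColoring [Fintype V] (G : SimpleGraph V) (c : V → ℕ) : Prop :=
  G.IsHamiltonianColoring c ∧ coloringValue c = G.hamiltonianChromaticNumber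

/-- The number `(n - 1)(n - ω) - 2 ℒ(G) + ξ`. -/
noncomputable def hcLowerBound [Fintype V] (G : SimpleGraph V) : ℤ :=
  ((Fintype.card V : ℤ) - 1) * ((Fintype.card V : ℤ) - (G.detourOmega : ℤ))
    - 2 * (G.totalDetourLevel : ℤ) + (G.detourXi : ℤ)

/-! ### Conditions on an ordering `u₀, …, uₙ₋₁` of the vertices -/

/-- `ℒ(u₀) = 0` and `ℒ(uₙ₋₁) = ξ` if `ω = 1`; `ℒ(u₀) = ℒ(uₙ₋₁) = 0` if `ω ≥ 2`. -/
def EndLevelCondition [Fintype V] (G : SimpleGraph V) (u : Fin (Fintype.card V) ≃ V) : Prop :=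
  (∀ i, i.val = 0 → G.detourLevel (u i) = 0) ∧
  (∀ i, i.val + 1 = Fintype.card V →
    (G.detourOmega = 1 → G.detourLevel (u i) = G.detourXi) ∧
    (2 ≤ G.detourOmega → G.detourLevel (u i) = 0))

/-- Consecutive vertices `uᵢ`, `uᵢ₊₁` are in different branches if `ω = 1` and in opposite
branches if `ω ≥ 2`. -/
def BranchCondition [Fintype V] (G : SimpleGraph V) (u : Fin (Fintype.card V) ≃ V) : Prop :=
  ∀ i j, j.val = i.val + 1 →
    (G.detourOmega = 1 → G.InDifferentBranches (u i) (u j)) ∧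
    (2 ≤ G.detourOmega → G.InOppositeBranches (u i) (u j))

/-- The map `c` satisfies `c(u₀) = 0` and `c(uᵢ₊₁) = c(uᵢ) + n - ω - ℒ(uᵢ₊₁) - ℒ(uᵢ)`. -/
def IsOrderingColoring [Fintype V] (G : SimpleGraph V) (u : Fin (Fintype.card V) ≃ V)
    (c : V → ℕ) : Prop :=
  (∀ i, i.val = 0 → c (u i) = 0) ∧
  ∀ i j, j.val = i.val + 1 →
    (c (u j) : ℤ) = (c (u i) : ℤ) + (Fintype.card V : ℤ) - (G.detourOmega : ℤ)
      - (G.detourLevel (u j) : ℤ) - (G.detourLevel (u i) : ℤ)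

/-- Star shaped: some ordering of the vertices satisfies the end-level and branch conditions. -/
def IsStarShaped [Fintype V] (G : SimpleGraph V) : Prop :=
  ∃ u : Fin (Fintype.card V) ≃ V, G.EndLevelCondition u ∧ G.BranchCondition u

/-- The detour diameter is at most `n / 2` (as rational numbers). -/
def IsDetourBoundHalf [Fintype V] (G : SimpleGraph V) : Prop :=
  (G.detourDiam : ℚ) ≤ (Fintype.card V : ℚ) / 2

/-- An `SDB(n/2)` block graph. -/
def IsSDBHalf [Fintype V] (G : SimpleGraph V) : Prop :=
  G.IsBlockGraph ∧ G.IsStarShaped ∧ G.IsDetourBoundHalf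

end SimpleGraph

/-! Everything rests on `D(u,v) + 1 ≤ ℒ(u) + ℒ(v) + ω` (`detourDist_add_one_le`), with equality for
vertices in different or opposite branches. The inequality holds because `D` is a metric and the
detour center is a single vertex or a clique block; the equality holds because `D` is additive
across separating vertices.

Lower bound: list the vertices by increasing color. Each gap is at least `n - 1 - D ≥ n - ω - ℒ -
ℒ`, and in the sum every level is counted twice except at the two ends, whose levels add up to at
least `ξ`.

Upper bound: under (a) and (b) all these estimates are equalities for the prescribed `c`. Pairs at
least two steps apart are handled by `𝒟 ≤ n/2`: two gaps already give `n - 2`, and `D ≥ 1` supplies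
the rest.

The block structure comes from gates (`IsBlock.exists_gate`): a block is entered from any given
vertex through one of its vertices. -/

namespace SimpleGraph

/-! ### Telescoping sums -/

/-- Summing the inequalities `cᵢ + K - lᵢ - lᵢ₊₁ ≤ cᵢ₊₁`. -/
theorem telescope_le {m : ℕ} (c l : Fin (m + 1) → ℤ) (K : ℤ)
    (h : ∀ i : Fin m, c i.castSucc + K - l i.castSucc - l i.succ ≤ c i.succ) :
    c 0 + m * K - 2 * ∑ i, l i + l 0 + l (Fin.last m) ≤ c (Fin.last m) := by
  induction m with
  | zero => simp; linarith
  | succ m ih =>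
    have h1 := ih (fun i => c i.castSucc) (fun i => l i.castSucc) fun i => h i.castSucc
    have h2 := h (Fin.last m)
    rw [Fin.sum_univ_castSucc]
    simp only [Fin.castSucc_zero, Fin.succ_last] at h1 h2
    push_cast
    linarith

theorem telescope_eq {m : ℕ} (c l : Fin (m + 1) → ℤ) (K : ℤ)
    (h : ∀ i : Fin m, c i.succ = c i.castSucc + K - l i.castSucc - l i.succ) :
    c (Fin.last m) = c 0 + m * K - 2 * ∑ i, l i + l 0 + l (Fin.last m) := by
  have h1 := telescope_le c l K fun i => (h i).ge
  -- The reverse inequality is the same lemma for the negated sequences.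
  have h2 := telescope_le (fun i => -c i) (fun i => -l i) (-K) fun i => by linarith [h i]
  rw [Finset.sum_neg_distrib] at h2
  linarith

variable {V : Type*} {G : SimpleGraph V}

/-! ### Separating vertices -/

/-- `x` lies on every walk from `a` to `b`. -/
def Separates (G : SimpleGraph V) (x a b : V) : Prop :=
  ∀ p : G.Walk a b, x ∈ p.support

theorem Separates.symm {x a b : V} (h : G.Separates x a b) : G.Separates x b a :=
  fun p => by simpa using h p.reverse

theorem Separates.dist_eq (hG : G.Connected) {x a b : V} (h : G.Separates x a b) :
    G.dist a b = G.dist a x + G.dist x b := by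
  classical
  obtain ⟨p, hp⟩ := hG.exists_walk_length_eq_dist a b
  have h1 := congrArg Walk.length (p.take_spec (h p))
  rw [Walk.length_append] at h1
  have h2 := dist_le (p.takeUntil x (h p))
  have h3 := dist_le (p.dropUntil x (h p))
  have h4 := hG.dist_triangle (u := a) (v := x) (w := b)
  omega

/-! ### Detour distance as a metric -/

theorem Walk.IsPath.append_of_forall_eq {a b d : V} {p : G.Walk a b} {q : G.Walk b d}
    (hp : p.IsPath) (hq : q.IsPath) (h : ∀ x ∈ p.support, x ∈ q.support → x = b) :
    (p.append q).IsPath := by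
  rw [Walk.isPath_def, Walk.support_append, List.nodup_append']
  have hq' := (Walk.isPath_def _).1 hq
  rw [← Walk.cons_tail_support, List.nodup_cons] at hq'
  refine ⟨(Walk.isPath_def _).1 hp, hq'.2, fun x hx hx' => ?_⟩
  have := h x hx (List.mem_of_mem_tail hx')
  subst this
  exact hq'.1 hx'

section Detour

variable [Fintype V]

theorem le_detourDist {a b : V} {p : G.Walk a b} (hp : p.IsPath) :
    p.length ≤ G.detourDist a b :=
  le_csSup ⟨Fintype.card V, by rintro _ ⟨q, hq, rfl⟩; exact hq.length_lt.le⟩ ⟨p, hp, rfl⟩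

theorem Connected.exists_isPath_length_eq_detourDist (hG : G.Connected) (a b : V) :
    ∃ p : G.Walk a b, p.IsPath ∧ p.length = G.detourDist a b := by
  classical
  obtain ⟨p⟩ := hG.preconnected a b
  exact Nat.sSup_mem (s := {l : ℕ | ∃ p : G.Walk a b, p.IsPath ∧ p.length = l})
    ⟨_, p.bypass, p.bypass_isPath, rfl⟩
    ⟨Fintype.card V, by rintro _ ⟨q, hq, rfl⟩; exact hq.length_lt.le⟩

theorem detourDist_comm (hG : G.Connected) (a b : V) : G.detourDist a b = G.detourDist b a := by
  have key : ∀ a b, G.detourDist a b ≤ G.detourDist b a := fun a b => by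
    obtain ⟨p, hp, hl⟩ := hG.exists_isPath_length_eq_detourDist a b
    rw [← hl, ← Walk.length_reverse]
    exact le_detourDist hp.reverse
  exact le_antisymm (key a b) (key b a)

theorem detourDist_self (hG : G.Connected) (a : V) : G.detourDist a a = 0 := by
  obtain ⟨p, hp, hl⟩ := hG.exists_isPath_length_eq_detourDist a a
  rw [← hl, Walk.length_eq_zero_iff.2 (Walk.isPath_iff_nil.1 hp)]

theorem detourDist_pos (hG : G.Connected) {a b : V} (h : a ≠ b) : 0 < G.detourDist a b := by
  obtain ⟨p, hp, hl⟩ := hG.exists_isPath_length_eq_detourDist a b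
  rw [← hl]
  by_contra h0
  exact h (Walk.eq_of_length_eq_zero (by omega : p.length = 0))

/-- On a longest `a`–`b` path choose `x` nearest to `w`. A geodesic from `x` to `w` meets the path
only at `x`, so it extends both pieces of the path to paths ending at `w`. -/
theorem detourDist_triangle (hG : G.Connected) (a b w : V) :
    G.detourDist a b ≤ G.detourDist a w + G.detourDist w b := by
  classical
  obtain ⟨p, hp, hl⟩ := hG.exists_isPath_length_eq_detourDist a b
  obtain ⟨x, hx, hmin⟩ := p.support.toFinset.exists_min_image (fun x => G.dist x w)
    ⟨a, by simp⟩
  rw [List.mem_toFinset] at hx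
  obtain ⟨q, hq, hql⟩ := hG.exists_path_of_dist x w
  have hpq : ∀ y ∈ p.support, y ∈ q.support → y = x := by
    intro y hy hyq
    by_contra hne
    have h1 := hmin y (List.mem_toFinset.2 hy)
    have h2 := q.length_dropUntil_lt_length hyq hne
    have h3 := dist_le (q.dropUntil y hyq)
    omega
  have h1 : ((p.takeUntil x hx).append q).IsPath :=
    (hp.takeUntil hx).append_of_forall_eq hq fun y hy =>
      hpq y (p.support_takeUntil_subset_support hx hy)
  have h2 : (q.reverse.append (p.dropUntil x hx)).IsPath :=
    hq.reverse.append_of_forall_eq (hp.dropUntil hx) fun y hy hy' =>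
      hpq y (p.support_dropUntil_subset_support hx hy') (by simpa using hy)
  have h3 := le_detourDist h1
  have h4 := le_detourDist h2
  have h5 := congrArg Walk.length (p.take_spec hx)
  simp only [Walk.length_append, Walk.length_reverse] at h3 h4 h5
  omega

/-- Longest paths `a`–`x` and `x`–`b` meet only at `x`: switching from one to the other at another
common vertex would bypass `x`. Hence their concatenation is a path. -/
theorem Separates.detourDist_eq (hG : G.Connected) {x a b : V} (h : G.Separates x a b) :
    G.detourDist a b = G.detourDist a x + G.detourDist x b := by
  classical
  refine le_antisymm (detourDist_triangle hG a b x) ?_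
  obtain ⟨p, hp, hl⟩ := hG.exists_isPath_length_eq_detourDist a x
  obtain ⟨q, hq, hl'⟩ := hG.exists_isPath_length_eq_detourDist x b
  have : (p.append q).IsPath := hp.append_of_forall_eq hq fun y hy hy' => by
    by_contra hne
    have := h ((p.takeUntil y hy).append (q.dropUntil y hy'))
    rw [Walk.mem_support_append_iff] at this
    rcases this with h1 | h1
    · exact Walk.endpoint_notMem_support_takeUntil hp hy (Ne.symm hne) h1
    · have h2 := Walk.endpoint_notMem_support_takeUntil hq.reverse (w := y) (by simpa using hy')
        (Ne.symm hne)
      have h3 := (Walk.isPath_def _).1 hq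
      rw [← q.take_spec hy', Walk.support_append] at h3
      have h4 := (List.nodup_append'.1 h3).2.2 (Walk.start_mem_support _)
      rw [Walk.mem_support_iff] at h1
      rcases h1 with h1 | h1
      · exact hne h1.symm
      · exact h4 h1
  rw [← hl, ← hl', ← Walk.length_append]
  exact le_detourDist this

end Detour

/-! ### Blocks -/

theorem IsNonseparable.preconnected_diff {B : Set V} (hB : G.IsNonseparable B) (v : V) :
    (G.induce (B \ {v})).Preconnected := by
  by_cases hv : v ∈ B
  · exact hB.2 v hv
  · rw [Set.sdiff_singleton_eq_self hv]
    exact hB.1.preconnected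

/-- Adding an ear creates no cut vertex: after deleting `v`, each remaining ear vertex still reaches
`B` along one of the two pieces of the path. -/
theorem IsNonseparable.union_support {B : Set V} (hB : G.IsNonseparable B) {a b : V}
    (ha : a ∈ B) (hb : b ∈ B) {p : G.Walk a b} (hp : p.IsPath) :
    G.IsNonseparable (B ∪ {x | x ∈ p.support}) := by
  classical
  refine ⟨induce_union_connected hB.1.preconnected p.connected_induce_support.preconnected
    ⟨a, ha, p.start_mem_support⟩, fun v _ => ?_⟩
  have claim : ∀ q ∈ (B ∪ {x | x ∈ p.support}) \ {v}, ∃ z ∈ B \ {v}, ∃ r : G.Walk q z,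
      ∀ x ∈ r.support, x ∈ (B ∪ {x | x ∈ p.support}) \ {v} := by
    rintro q ⟨hq | hq, hqv⟩
    · exact ⟨q, ⟨hq, hqv⟩, .nil, by simpa using ⟨Or.inl hq, hqv⟩⟩
    · have hq : q ∈ p.support := hq
      by_cases h1 : v ∈ (p.takeUntil q hq).support
      · have h2 : v ∉ (p.dropUntil q hq).support := fun h2 => by
          have hp' := hp
          rw [← p.take_spec hq] at hp'
          exact hp'.ne_of_mem_support_of_append (fun h => hqv h.symm) h1 h2 rfl
        refine ⟨b, ⟨hb, ?_⟩, p.dropUntil q hq, fun x hx =>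
          ⟨Or.inr (p.support_dropUntil_subset_support hq hx), ?_⟩⟩
        · rintro rfl; exact h2 (Walk.end_mem_support _)
        · rintro rfl; exact h2 hx
      · refine ⟨a, ⟨ha, ?_⟩, (p.takeUntil q hq).reverse, fun x hx => ?_⟩
        · rintro rfl; exact h1 (Walk.start_mem_support _)
        · rw [Walk.support_reverse, List.mem_reverse] at hx
          refine ⟨Or.inr (p.support_takeUntil_subset_support hq hx), ?_⟩
          rintro rfl; exact h1 hx
  rintro ⟨q, hq⟩ ⟨q', hq'⟩
  obtain ⟨z, hz, r, hr⟩ := claim q hq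
  obtain ⟨z', hz', r', hr'⟩ := claim q' hq'
  have hsub : B \ {v} ⊆ (B ∪ {x | x ∈ p.support}) \ {v} :=
    Set.sdiff_subset_sdiff_left Set.subset_union_left
  have h := (hB.preconnected_diff v ⟨z, hz⟩ ⟨z', hz'⟩).map (induceHomOfLE G hsub).toHom
  exact ((r.induce _ hr).reachable.trans h).trans (r'.induce _ hr').reachable.symm

theorem IsBlock.mem_of_mem_support {B : Set V} (hB : G.IsBlock B) {a b : V}
    (ha : a ∈ B) (hb : b ∈ B) {p : G.Walk a b} (hp : p.IsPath) {x : V}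
    (hx : x ∈ p.support) : x ∈ B :=
  hB.2 (hB.1.union_support ha hb hp) Set.subset_union_left (Or.inr hx)

theorem IsBlock.nonempty {B : Set V} (hB : G.IsBlock B) : B.Nonempty :=
  Set.nonempty_coe_sort.1 hB.1.1.nonempty

theorem Adj.exists_isBlock [Finite V] {a b : V} (h : G.Adj a b) :
    ∃ B, G.IsBlock B ∧ a ∈ B ∧ b ∈ B := by
  have hn : G.IsNonseparable {a, b} := by
    refine ⟨induce_pair_connected_of_adj h, fun v hv => ?_⟩
    have : ((({a, b} : Set V) \ {v} : Set V)).Subsingleton := by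
      rintro x ⟨hx, hxv⟩ y ⟨hy, hyv⟩
      simp only [Set.mem_insert_iff, Set.mem_singleton_iff] at hx hy hv hxv hyv
      grind
    have := this.coe_sort
    exact Preconnected.of_subsingleton
  obtain ⟨B, hle, hB⟩ := Finite.exists_le_maximal (p := G.IsNonseparable) hn
  exact ⟨B, hB, hle (by simp), hle (by simp)⟩

/-- Every vertex `y` of a connected graph reaches a block `B` through a single vertex of `B`. -/
theorem IsBlock.exists_gate (hG : G.Connected) {B : Set V} (hB : G.IsBlock B) (y : V) :
    ∃ g ∈ B, ∀ z ∈ B, G.Separates g z y := by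
  classical
  obtain ⟨g, hg, hmin⟩ : ∃ g ∈ B, ∀ z ∈ B, G.dist g y ≤ G.dist z y := by
    have hw := (wellFounded_lt (α := ℕ)).has_min ((fun z => G.dist z y) '' B)
      (hB.nonempty.image _)
    obtain ⟨_, ⟨g, hg, rfl⟩, h⟩ := hw
    exact ⟨g, hg, fun z hz => not_lt.1 (h _ ⟨z, hz, rfl⟩)⟩
  refine ⟨g, hg, ?_⟩
  by_contra hcon
  -- A shortest walk from `B` to `y` avoiding `g` meets `B` only at its start.
  have hex : ∃ n : ℕ, ∃ z ∈ B, ∃ r : G.Walk z y, g ∉ r.support ∧ r.length = n := by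
    simp only [Separates, not_forall] at hcon
    obtain ⟨z, hz, r, hr⟩ := hcon
    exact ⟨_, z, hz, r, hr, rfl⟩
  obtain ⟨z, hz, r, hgr, hl⟩ := Nat.find_spec hex
  have hmin' := fun m => Nat.find_min hex (m := m)
  have hr : ∀ x ∈ r.support, x ∈ B → x = z := by
    intro x hx hxB
    by_contra hne
    have h1 := r.length_dropUntil_lt_length hx hne
    exact hmin' _ (hl ▸ h1) ⟨x, hxB, r.dropUntil x hx,
      fun h => hgr (r.support_dropUntil_subset_support hx h), rfl⟩
  obtain ⟨q, hq⟩ := hG.exists_walk_length_eq_dist g y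
  have hq' : ∀ x ∈ q.support, x ∈ B → x = g := by
    intro x hx hxB
    by_contra hne
    have h1 := q.length_dropUntil_lt_length hx hne
    have h2 := dist_le (q.dropUntil x hx)
    have h3 := hmin x hxB
    omega
  have hzg : z ≠ g := by
    rintro rfl
    exact hgr r.start_mem_support
  -- As an ear, `t` stays inside `B`, where it can only visit `z` and `g`. So it is the edge `zg`,
  -- which neither `r` nor `q` contains.
  let t := (r.append q.reverse).bypass
  have ht : t.IsPath := Walk.bypass_isPath _
  have htB : ∀ x ∈ t.support, x = z ∨ x = g := by
    intro x hx
    have hxB := hB.mem_of_mem_support hz hg ht hx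
    have := Walk.support_bypass_subset_support _ hx
    rw [Walk.mem_support_append_iff, Walk.support_reverse, List.mem_reverse] at this
    exact this.imp (fun h => hr x h hxB) (fun h => hq' x h hxB)
  have hmem : s(z, g) ∈ t.edges := by
    generalize t = t at ht htB
    cases t with
    | nil => exact absurd rfl hzg
    | cons h s =>
      rename_i w
      have : w = g := (htB w (by simp)).resolve_left h.ne'
      subst this
      simp
  have := Walk.edges_bypass_subset_edges _ hmem
  rw [Walk.edges_append, Walk.edges_reverse, List.mem_append, List.mem_reverse] at this
  rcases this with h | h
  · exact hgr (Walk.snd_mem_support_of_mem_edges _ h)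
  · exact hzg (hq' z (Walk.fst_mem_support_of_mem_edges _ h) hz)

/-- A Hamiltonian path of the clique: go from `z` to the newly inserted vertex and continue from
there by induction. -/
theorem exists_isPath_length_of_isClique (S : Finset V) :
    ∀ {z g : V}, z ≠ g → z ∉ S → g ∉ S → G.IsClique (insert z (insert g (S : Set V))) →
      ∃ p : G.Walk z g, p.IsPath ∧ p.length = S.card + 1 ∧
        ∀ x ∈ p.support, x = z ∨ x = g ∨ x ∈ S := by
  classical
  induction S using Finset.induction_on with
  | empty =>
    intro z g hzg _ _ hc
    have h : G.Adj z g := hc (by simp) (by simp) hzg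
    exact ⟨h.toWalk, h.isPath_toWalk, by simp, by simp⟩
  | insert s S hs ih =>
    intro z g hzg hz hg hc
    rw [Finset.mem_insert, not_or] at hz hg
    obtain ⟨p, hp, hl, hsup⟩ := ih (Ne.symm hg.1) hs hg.2 (hc.subset (by
      intro x hx
      simp only [Set.mem_insert_iff, Finset.coe_insert] at hx ⊢
      tauto))
    have h : G.Adj z s := hc (by simp) (by simp) hz.1
    refine ⟨.cons h p, hp.cons fun hmem => ?_, ?_, fun x hx => ?_⟩
    · rcases hsup z hmem with h | h | h
      · exact hz.1 h
      · exact hzg h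
      · exact hz.2 h
    · rw [Walk.length_cons, hl, Finset.card_insert_of_notMem hs]
    · rw [Walk.support_cons, List.mem_cons] at hx
      rcases hx with h | h
      · exact Or.inl h
      · rw [Finset.mem_insert]
        have := hsup x h
        tauto

theorem IsBlockGraph.adj {B : Set V} (hG : G.IsBlockGraph) (hB : G.IsBlock B) {a b : V}
    (ha : a ∈ B) (hb : b ∈ B) (hab : a ≠ b) : G.Adj a b :=
  hG.2 B hB ha hb hab

/-- Two blocks of a block graph with two common vertices coincide. -/
theorem IsBlockGraph.block_eq (hG : G.IsBlockGraph) {B B' : Set V} (hB : G.IsBlock B)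
    (hB' : G.IsBlock B') {a b : V} (hab : a ≠ b) (ha : a ∈ B) (hb : b ∈ B) (ha' : a ∈ B')
    (hb' : b ∈ B') : B = B' := by
  refine hB'.eq_of_ge hB.1 fun x hx => ?_
  by_cases hxa : x = a
  · exact hxa ▸ ha
  by_cases hxb : x = b
  · exact hxb ▸ hb
  have h1 := hG.adj hB' ha' hx (Ne.symm hxa)
  have h2 := hG.adj hB' hx hb' hxb
  refine hB.mem_of_mem_support ha hb (p := .cons h1 h2.toWalk) ?_ (x := x) (by simp)
  exact h2.isPath_toWalk.cons (by simp [Ne.symm hxa, hab])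

/-- The block of a block graph through which a shortest path from `w` to `v` starts. -/
theorem Connected.exists_isBlock_gate_ne [Finite V] (hG : G.Connected) {w v : V} (h : v ≠ w) :
    ∃ B, G.IsBlock B ∧ w ∈ B ∧ ∃ g ∈ B, g ≠ w ∧ ∀ z ∈ B, G.Separates g z v := by
  obtain ⟨p, hp⟩ := hG.exists_walk_length_eq_dist w v
  cases p with
  | nil => exact absurd rfl h
  | @cons _ x _ hx p =>
    obtain ⟨B, hB, hwB, hxB⟩ := hx.exists_isBlock
    obtain ⟨g, hg, hgate⟩ := hB.exists_gate hG v
    refine ⟨B, hB, hwB, g, hg, ?_, hgate⟩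
    -- If the gate were `w`, the next vertex `x` of the geodesic could reach `v` only by going back
    -- through `w`.
    rintro rfl
    have h1 := (hgate x hxB).dist_eq hG
    have h2 := dist_le p
    rw [Walk.length_cons] at hp
    omega

variable [Fintype V]

/-- Distinct vertices of a block `B` of a block graph have detour distance `|B| - 1`. -/
theorem IsBlockGraph.detourDist_add_one_eq (hG : G.IsBlockGraph) {B : Set V} (hB : G.IsBlock B)
    {a b : V} (ha : a ∈ B) (hb : b ∈ B) (hab : a ≠ b) : G.detourDist a b + 1 = B.ncard := by
  classical
  apply le_antisymm
  · obtain ⟨p, hp, hl⟩ := hG.1.exists_isPath_length_eq_detourDist a b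
    rw [← hl, ← Walk.length_support, ← List.toFinset_card_of_nodup ((Walk.isPath_def _).1 hp),
      ← Set.ncard_coe_finset]
    refine Set.ncard_le_ncard (fun x hx => ?_) (Set.toFinite B)
    exact hB.mem_of_mem_support ha hb hp (by simpa using hx)
  · have hsub : B = insert a (insert b (B \ {a, b})) := by
      ext x
      simp only [Set.mem_insert_iff, Set.mem_sdiff, Set.mem_singleton_iff]
      grind
    have hc := hG.2 B hB
    rw [hsub] at hc
    obtain ⟨p, hp, hl, -⟩ := exists_isPath_length_of_isClique (G := G) (B \ {a, b}).toFinset hab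
      (by simp) (by simp) (by simpa using hc)
    have h1 := le_detourDist hp
    rw [hl] at h1
    have h2 : B.ncard = (B \ {a, b}).toFinset.card + 2 := by
      rw [← Set.ncard_eq_toFinset_card', ← Set.ncard_pair hab]
      exact (Set.ncard_sdiff_add_ncard_of_subset (by
        rintro x (rfl | rfl)
        · exact ha
        · exact hb)).symm
    omega

/-! ### The detour center -/

theorem detourDist_le_detourEcc (v u : V) : G.detourDist v u ≤ G.detourEcc v :=
  Finset.le_sup (f := fun u => G.detourDist v u) (Finset.mem_univ u)

theorem exists_detourDist_eq_detourEcc (v : V) : ∃ u, G.detourDist v u = G.detourEcc v := by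
  obtain ⟨u, -, hu⟩ := Finset.exists_mem_eq_sup Finset.univ ⟨v, Finset.mem_univ v⟩
    fun u => G.detourDist v u
  exact ⟨u, hu.symm⟩

theorem detourCenter_nonempty [Nonempty V] : G.detourCenter.Nonempty := by
  obtain ⟨v, -, hv⟩ := Finset.exists_min_image Finset.univ G.detourEcc Finset.univ_nonempty
  exact ⟨v, fun u => hv u (Finset.mem_univ u)⟩

theorem one_le_detourOmega [Nonempty V] : 1 ≤ G.detourOmega :=
  (Set.ncard_pos (Set.toFinite _)).2 detourCenter_nonempty

/-- Let `y` be farthest from `x`. If `x` separated a central `v ≠ x` from `y`, additivity would make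
the eccentricity of `v` exceed that of `x`. So `w` and `w'` both reach `y` avoiding `x`, hence each
other. -/
theorem Connected.eq_or_eq_of_separates (hG : G.Connected) {w w' x : V} (hw : w ∈ G.detourCenter)
    (hw' : w' ∈ G.detourCenter) (h : G.Separates x w w') : x = w ∨ x = w' := by
  by_contra! hne
  obtain ⟨y, hy⟩ := G.exists_detourDist_eq_detourEcc x
  have key : ∀ v ∈ G.detourCenter, x ≠ v → ∃ p : G.Walk v y, x ∉ p.support := by
    intro v hv hxv
    by_contra! hcon
    have h1 := Separates.detourDist_eq hG (show G.Separates x v y from hcon)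
    have h2 := detourDist_pos hG hxv.symm
    have h3 := G.detourDist_le_detourEcc v y
    have h4 := hv x
    omega
  obtain ⟨p, hp⟩ := key w hw hne.1
  obtain ⟨q, hq⟩ := key w' hw' hne.2
  have := h (p.append q.reverse)
  rw [Walk.mem_support_append_iff, Walk.support_reverse, List.mem_reverse] at this
  exact this.elim hp hq

/-- If there are several detour central vertices, they form a block. -/
theorem IsBlockGraph.isBlock_detourCenter (hG : G.IsBlockGraph) {w w' : V}
    (hw : w ∈ G.detourCenter) (hw' : w' ∈ G.detourCenter) (hne : w ≠ w') :
    G.IsBlock G.detourCenter := by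
  have hcommon : ∀ v ∈ G.detourCenter, ∀ v' ∈ G.detourCenter, v ≠ v' →
      ∃ B, G.IsBlock B ∧ v ∈ B ∧ v' ∈ B := by
    intro v hv v' hv' hvv
    obtain ⟨B, hB, hvB, g, hg, hgv, hgate⟩ := hG.1.exists_isBlock_gate_ne hvv.symm
    have := (hG.1.eq_or_eq_of_separates hv hv' (hgate v hvB)).resolve_left hgv
    exact ⟨B, hB, hvB, this ▸ hg⟩
  have hadj : ∀ v ∈ G.detourCenter, ∀ v' ∈ G.detourCenter, v ≠ v' → G.Adj v v' := by
    intro v hv v' hv' hvv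
    obtain ⟨B, hB, h, h'⟩ := hcommon v hv v' hv' hvv
    exact hG.adj hB h h' hvv
  obtain ⟨B, hB, hwB, hwB'⟩ := hcommon w hw w' hw' hne
  suffices G.detourCenter = B from this ▸ hB
  refine Set.Subset.antisymm (fun x hx => ?_) (fun x hx u => ?_)
  -- The edges from `w` and `w'` to a central `x` outside `B` would both have to contain the gate,
  -- which cannot equal both `w` and `w'`.
  · obtain ⟨g, hg, hgate⟩ := hB.exists_gate hG.1 x
    have key : ∀ v ∈ G.detourCenter, v ∈ B → g = v ∨ x ∈ B := by
      intro v hv hvB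
      by_cases hvx : v = x
      · exact Or.inr (hvx ▸ hvB)
      have := hgate v hvB (hadj v hv x hx hvx).toWalk
      simp only [Adj.support_toWalk, List.mem_cons, List.not_mem_nil, or_false] at this
      exact this.imp_right fun (h : g = x) => h ▸ hg
    rcases key w hw hwB with h | h
    · exact (key w' hw' hwB').resolve_left fun h' => hne (h.symm.trans h')
    · exact h
  -- With `g` the gate of a vertex `y` farthest from `x`, a central `v ≠ g` in `B` is as far from
  -- `g` as any vertex of `B` can be, so `x` has eccentricity at most that of `v`.
  · obtain ⟨y, hy⟩ := G.exists_detourDist_eq_detourEcc x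
    obtain ⟨g, hg, hgate⟩ := hB.exists_gate hG.1 y
    obtain ⟨v, hv, hvB, hvg⟩ : ∃ v ∈ G.detourCenter, v ∈ B ∧ v ≠ g := by
      by_cases h : w = g
      · exact ⟨w', hw', hwB', fun h' => hne (h.trans h'.symm)⟩
      · exact ⟨w, hw, hwB, h⟩
    have h1 := (hgate v hvB).detourDist_eq hG.1
    have h2 := (hgate x hx).detourDist_eq hG.1
    have h3 := hG.detourDist_add_one_eq hB hvB hg hvg
    have h4 : G.detourDist x g + 1 ≤ B.ncard := by
      by_cases hxg : x = g
      · rw [hxg, detourDist_self hG.1]; omega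
      · exact (hG.detourDist_add_one_eq hB hx hg hxg).le
    have h5 := G.detourDist_le_detourEcc v y
    have h6 := hv u
    omega

theorem IsBlockGraph.detourDist_center (hG : G.IsBlockGraph) {w w' : V}
    (hw : w ∈ G.detourCenter) (hw' : w' ∈ G.detourCenter) (hne : w ≠ w') :
    G.detourDist w w' + 1 = G.detourOmega :=
  hG.detourDist_add_one_eq (hG.isBlock_detourCenter hw hw' hne) hw hw' hne

/-! ### Detour levels -/

theorem detourLevel_le {w : V} (hw : w ∈ G.detourCenter) (u : V) :
    G.detourLevel u ≤ G.detourDist w u :=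
  Nat.sInf_le ⟨w, hw, rfl⟩

theorem exists_detourDist_eq_detourLevel [Nonempty V] (u : V) :
    ∃ w ∈ G.detourCenter, G.detourDist w u = G.detourLevel u := by
  obtain ⟨w, hw⟩ := G.detourCenter_nonempty
  exact Nat.sInf_mem (s := {l | ∃ w ∈ G.detourCenter, G.detourDist w u = l}) ⟨_, w, hw, rfl⟩

/-- Apply the triangle inequality through the central vertices nearest to `u` and `v`, which are at
detour distance at most `ω - 1`. -/
theorem IsBlockGraph.detourDist_add_one_le (hG : G.IsBlockGraph) (u v : V) :
    G.detourDist u v + 1 ≤ G.detourLevel u + G.detourLevel v + G.detourOmega := by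
  have := hG.1.nonempty
  obtain ⟨w, hw, hwu⟩ := G.exists_detourDist_eq_detourLevel u
  obtain ⟨w', hw', hwv⟩ := G.exists_detourDist_eq_detourLevel v
  have h1 := detourDist_triangle hG.1 u v w
  have h2 := detourDist_triangle hG.1 w v w'
  have h3 := detourDist_comm hG.1 u w
  have h4 : G.detourDist w w' + 1 ≤ G.detourOmega := by
    by_cases h : w = w'
    · rw [h, detourDist_self hG.1]
      exact one_le_detourOmega
    · exact (hG.detourDist_center hw hw' h).le
  omega

theorem detourLevel_eq_of_detourOmega_eq_one [Nonempty V] (h : G.detourOmega = 1) {w : V}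
    (hw : w ∈ G.detourCenter) (u : V) : G.detourLevel u = G.detourDist w u := by
  obtain ⟨w', hw', hwu⟩ := G.exists_detourDist_eq_detourLevel u
  obtain ⟨a, ha⟩ := Set.ncard_eq_one.1 h
  rw [ha, Set.mem_singleton_iff] at hw hw'
  rw [← hwu, hw, hw']

/-- When `ω = 1`, a path from the center to `v` must cross an attached block `B`, from the center to
a different gate, and that alone contributes `|B| - 1`. -/
theorem IsBlockGraph.detourXi_le_detourLevel (hG : G.IsBlockGraph) {v : V}
    (hv : v ∉ G.detourCenter) : G.detourXi ≤ G.detourLevel v := by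
  have := hG.1.nonempty
  rw [detourXi]
  split_ifs with h
  · obtain ⟨w, hw⟩ := G.detourCenter_nonempty
    have hvw : v ≠ w := fun h => hv (h ▸ hw)
    rw [detourLevel_eq_of_detourOmega_eq_one h hw]
    obtain ⟨B, hB, hwB, g, hg, hgw, hgate⟩ := hG.1.exists_isBlock_gate_ne hvw
    have h1 := (hgate w hwB).detourDist_eq hG.1
    have h2 := hG.detourDist_add_one_eq hB hwB hg hgw.symm
    have hne : B ≠ G.detourCenter := by
      rintro rfl
      have h3 := hG.detourDist_center hwB hg hgw.symm
      have h4 := detourDist_pos hG.1 hgw.symm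
      omega
    have h3 : sInf {k : ℕ | ∃ w B, G.IsAttachedBlock w B ∧ B.ncard - 1 = k} ≤ B.ncard - 1 :=
      Nat.sInf_le ⟨w, B, ⟨hw, hB, hwB, hne⟩, rfl⟩
    omega
  · exact Nat.zero_le _

/-! ### Branches -/

/-- An ancestor `x ≠ w` lies on a geodesic from `w` to `u`. If every `x`–`u` walk returned to `w`,
then `x` would be farther from `u` than `w` is. -/
theorem IsBlockGraph.exists_walk_of_mem_detourBranch (hG : G.IsBlockGraph)
    (h1 : G.detourOmega = 1) {w u : V} {B : Set V} (hB : G.IsAttachedBlock w B)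
    (hu : u ∈ G.detourBranch B) (huw : u ≠ w) :
    ∃ x ∈ B, x ≠ w ∧ ∃ p : G.Walk x u, w ∉ p.support := by
  rcases hu with hu | ⟨x, hxB, hx, w', hw', -, hdist⟩
  · exact ⟨u, hu, huw, .nil, by simpa using huw.symm⟩
  · obtain ⟨a, ha⟩ := Set.ncard_eq_one.1 h1
    have hw := hB.1
    rw [ha, Set.mem_singleton_iff] at hw hw' hx
    subst hw hw'
    refine ⟨x, hxB, hx, ?_⟩
    by_contra! hcon
    have h2 := Separates.dist_eq hG.1 (show G.Separates w' x u from hcon)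
    have h3 := hG.1.pos_dist_of_ne hx
    omega

theorem IsBlockGraph.detourDist_of_inDifferentBranches (hG : G.IsBlockGraph)
    (h1 : G.detourOmega = 1) {u v : V} (h : G.InDifferentBranches u v) :
    G.detourDist u v + 1 = G.detourLevel u + G.detourLevel v + G.detourOmega := by
  classical
  have := hG.1.nonempty
  obtain ⟨w, B, B', hB, hB', hne, hu, hv⟩ := h
  rw [detourLevel_eq_of_detourOmega_eq_one h1 hB.1, detourLevel_eq_of_detourOmega_eq_one h1 hB.1,
    h1, detourDist_comm hG.1 w u]
  -- A `u`–`v` walk avoiding `w` would link `B` to some `x' ≠ w` in `B'` off `w`. Closing up with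
  -- the edge `x'w` gives an ear on `B`, so `B` and `B'` would share `x'` and `w`.
  suffices h : G.Separates w u v by rw [h.detourDist_eq hG.1]
  intro p
  by_contra hp
  obtain ⟨x, hx, hxw, q, hq⟩ := hG.exists_walk_of_mem_detourBranch h1 hB hu
    fun h => hp (h ▸ p.start_mem_support)
  obtain ⟨x', hx', hxw', q', hq'⟩ := hG.exists_walk_of_mem_detourBranch h1 hB' hv
    fun h => hp (h ▸ p.end_mem_support)
  let r := (q.append (p.append q'.reverse)).bypass
  have hr : w ∉ r.support := fun h => by
    have := Walk.support_bypass_subset_support _ h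
    rw [Walk.mem_support_append_iff, Walk.mem_support_append_iff, Walk.support_reverse,
      List.mem_reverse] at this
    tauto
  have hadj := hG.adj hB'.2.1 hx' hB'.2.2.1 hxw'
  have hpath : (r.concat hadj).IsPath := (Walk.bypass_isPath _).concat hr hadj
  have hxB : x' ∈ B := hB.2.1.mem_of_mem_support hx hB.2.2.1 hpath (by simp [Walk.support_concat])
  exact hne (hG.block_eq hB.2.1 hB'.2.1 hxw' hxB hB.2.2.1 hx' hB'.2.2.1)

/-- The claim is that the gate of `u` in the central block is `w`. -/
theorem IsBlockGraph.separates_of_mem_detourSide (hG : G.IsBlockGraph)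
    (hC : G.IsBlock G.detourCenter) {w u : V} (hw : w ∈ G.detourCenter)
    (hu : u ∈ G.detourSide w) : ∀ z ∈ G.detourCenter, G.Separates w z u := by
  classical
  rcases hu with rfl | ⟨B, hB, hu⟩
  · exact fun z _ p => p.end_mem_support
  have hcap : ∀ x ∈ B, x ≠ w → x ∉ G.detourCenter := fun x hx hxw hxC =>
    hB.2.2.2 (hG.block_eq hB.2.1 hC hxw hx hB.2.2.1 hxC hw)
  obtain ⟨g, hg, hgate⟩ := hC.exists_gate hG.1 u
  suffices g = w from this ▸ hgate
  by_contra hgw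
  rcases hu with hu | ⟨x, hxB, hx, w', hw', -, hdist⟩
  · by_cases huw : u = w
    · subst huw
      have := hgate u hw .nil
      simp only [Walk.support_nil, List.mem_singleton] at this
      exact hgw this
    · have := hgate w hw (hG.adj hB.2.1 hB.2.2.1 hu (Ne.symm huw)).toWalk
      simp only [Adj.support_toWalk, List.mem_cons, List.not_mem_nil, or_false] at this
      exact hcap u hu huw (this.resolve_left hgw ▸ hg)
  · have hxw : x ≠ w := fun h => hx (h ▸ hw)
    have hxg : x ≠ g := fun h => hx (h ▸ hg)
    have hxw' : x ≠ w' := fun h => hx (h ▸ hw')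
    -- Since `x` is adjacent to `w`, its walks to `u` also pass the gate `g`. Then a route from `w'`
    -- through `x` costs at least 2 before reaching `g`, while `w'` is within 1 of `g`, so `x` is
    -- not on a geodesic.
    have hsep : G.Separates g x u := fun p => by
      have := hgate w hw (.cons (hG.adj hB.2.1 hB.2.2.1 hxB hxw.symm) p)
      rw [Walk.support_cons, List.mem_cons] at this
      exact this.resolve_left hgw
    have h1 := hsep.dist_eq hG.1
    have h2 := (hgate w' hw').dist_eq hG.1
    have h3 : G.dist w' g ≤ 1 := by
      by_cases h : w' = g
      · simp [h]
      · exact (dist_eq_one_iff_adj.2 (hG.adj hC hw' hg h)).le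
    have h4 := hG.1.pos_dist_of_ne hxg
    have h5 := hG.1.pos_dist_of_ne hxw'.symm
    omega

theorem detourLevel_eq_of_separates (hG : G.Connected) {w u : V} (hw : w ∈ G.detourCenter)
    (h : ∀ z ∈ G.detourCenter, G.Separates w z u) : G.detourLevel u = G.detourDist w u := by
  have := hG.nonempty
  refine le_antisymm (detourLevel_le hw u) ?_
  obtain ⟨z, hz, hzu⟩ := G.exists_detourDist_eq_detourLevel u
  have := (h z hz).detourDist_eq hG
  omega

theorem IsBlockGraph.detourDist_of_inOppositeBranches (hG : G.IsBlockGraph) {u v : V}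
    (h : G.InOppositeBranches u v) :
    G.detourDist u v + 1 = G.detourLevel u + G.detourLevel v + G.detourOmega := by
  classical
  obtain ⟨w, hw, w', hw', hne, hu, hv⟩ := h
  have hC := hG.isBlock_detourCenter hw hw' hne
  have hsu := hG.separates_of_mem_detourSide hC hw hu
  have hsv := hG.separates_of_mem_detourSide hC hw' hv
  rw [detourLevel_eq_of_separates hG.1 hw hsu, detourLevel_eq_of_separates hG.1 hw' hsv,
    ← hG.detourDist_center hw hw' hne]
  -- Some `w'`–`v` walk avoids `w`, since `w` and `w'` cannot each separate the other from `v`.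
  -- Joined to a `u`–`v` walk avoiding `w`, it would reach `u` from `w'` without passing `w`.
  have hsep : G.Separates w u v := fun p => by
    by_contra hp
    obtain ⟨q, hq⟩ : ∃ q : G.Walk w' v, w ∉ q.support := by
      by_contra! hcon
      have h1 := Separates.dist_eq hG.1 (show G.Separates w w' v from hcon)
      have h2 := (hsv w hw).dist_eq hG.1
      have h3 := hG.1.pos_dist_of_ne hne
      omega
    have := hsu w' hw' (q.append p.reverse)
    rw [Walk.mem_support_append_iff, Walk.support_reverse, List.mem_reverse] at this
    exact this.elim hq hp
  rw [hsep.detourDist_eq hG.1, (hsv w hw).detourDist_eq hG.1, detourDist_comm hG.1 u w]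
  omega

/-! ### Hamiltonian colorings -/

theorem detourXi_eq_zero_of_subsingleton [Subsingleton V] : G.detourXi = 0 := by
  rw [detourXi]
  split_ifs
  -- The only nonempty vertex set is the center itself, so no block is attached and the infimum
  -- takes its default value 0.
  · have : {k : ℕ | ∃ w B, G.IsAttachedBlock w B ∧ B.ncard - 1 = k} = ∅ := by
      rw [Set.eq_empty_iff_forall_notMem]
      rintro k ⟨w, B, ⟨hw, -, hwB, hne⟩, -⟩
      apply hne
      ext x
      rw [Subsingleton.elim x w]
      simp [hw, hwB]
    rw [this, Nat.sInf_empty]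
  · rfl

/-- If `ω = 1`, at least one of two distinct vertices is not central; otherwise `ξ = 0`. -/
theorem IsBlockGraph.detourXi_le_add (hG : G.IsBlockGraph) {a b : V} (hab : a ≠ b) :
    G.detourXi ≤ G.detourLevel a + G.detourLevel b := by
  by_cases ha : a ∈ G.detourCenter
  · by_cases hb : b ∈ G.detourCenter
    · have h : G.detourOmega ≠ 1 := fun h => by
        obtain ⟨w, hw⟩ := Set.ncard_eq_one.1 h
        rw [hw, Set.mem_singleton_iff] at ha hb
        exact hab (ha.trans hb.symm)
      simp [detourXi, h]
    · exact (hG.detourXi_le_detourLevel hb).trans (Nat.le_add_left _ _)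
  · exact (hG.detourXi_le_detourLevel ha).trans (Nat.le_add_right _ _)

theorem IsBlockGraph.hcLowerBound_le (hG : G.IsBlockGraph) {c : V → ℕ}
    (hc : G.IsHamiltonianColoring c) : G.hcLowerBound ≤ coloringValue c := by
  have := hG.1.nonempty
  obtain ⟨m, hm⟩ := Nat.exists_eq_succ_of_ne_zero (Fintype.card_ne_zero (α := V))
  obtain ⟨f, hf⟩ : ∃ f : Fin (m + 1) ≃ V, Monotone fun i => c (f i) := by
    let e := (Fintype.equivFinOfCardEq hm).symm
    exact ⟨(Tuple.sort (c ∘ e)).trans e, Tuple.monotone_sort (c ∘ e)⟩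
  have h1 := telescope_le (fun i => (c (f i) : ℤ)) (fun i => (G.detourLevel (f i) : ℤ))
    ((Fintype.card V : ℤ) - G.detourOmega) fun i => by
      have h2 := hc (f i.castSucc) (f i.succ) (f.injective.ne i.castSucc_lt_succ.ne)
      have h3 : c (f i.castSucc) ≤ c (f i.succ) := hf i.castSucc_lt_succ.le
      have h4 := hG.detourDist_add_one_le (f i.castSucc) (f i.succ)
      rw [abs_sub_comm, abs_of_nonneg (by omega)] at h2
      omega
  have h2 : G.detourXi ≤ G.detourLevel (f 0) + G.detourLevel (f (Fin.last m)) := by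
    rcases Nat.eq_zero_or_pos m with rfl | hpos
    · have : Subsingleton V := Fintype.card_le_one_iff_subsingleton.1 hm.le
      simp [detourXi_eq_zero_of_subsingleton]
    · refine hG.detourXi_le_add (f.injective.ne fun h => ?_)
      have := congrArg Fin.val h
      simp at this
      omega
  have h3 : c (f (Fin.last m)) ≤ coloringValue c := Finset.le_sup (Finset.mem_univ _)
  have h4 : (∑ i, (G.detourLevel (f i) : ℤ)) = G.totalDetourLevel := by
    rw [totalDetourLevel, Nat.cast_sum]
    exact f.sum_comp fun v => (G.detourLevel v : ℤ)
  rw [h4] at h1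
  have h5 : (Fintype.card V : ℤ) - 1 = m := by rw [hm]; push_cast; ring
  rw [hcLowerBound, h5]
  have h6 : (0 : ℤ) ≤ c (f 0) := Int.natCast_nonneg _
  zify at h2 h3
  linarith

theorem IsBlockGraph.isOptimal_of_coloringValue_eq (hG : G.IsBlockGraph) {c : V → ℕ}
    (hc : G.IsHamiltonianColoring c) (h : (coloringValue c : ℤ) = G.hcLowerBound) :
    G.IsOptimalHamiltonianColoring c := by
  refine ⟨hc, le_antisymm ?_ (Nat.sInf_le ⟨c, hc, rfl⟩)⟩
  obtain ⟨c', hc', h'⟩ := Nat.sInf_mem (s := {k : ℕ | ∃ c : V → ℕ,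
    G.IsHamiltonianColoring c ∧ coloringValue c = k}) ⟨_, c, hc, rfl⟩
  have h1 := hG.hcLowerBound_le hc'
  rw [hamiltonianChromaticNumber, ← h']
  omega

theorem IsBlockGraph.exists_coloring_of_ordering (hG : G.IsBlockGraph) {m : ℕ}
    (hm : Fintype.card V = m + 1) (u : Fin (m + 1) ≃ V)
    (hdiam : ∀ a b, 2 * G.detourDist a b ≤ m + 1)
    (hstep : ∀ i : Fin m, G.detourDist (u i.castSucc) (u i.succ) + 1 =
      G.detourLevel (u i.castSucc) + G.detourLevel (u i.succ) + G.detourOmega)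
    (h0 : G.detourLevel (u 0) = 0) (hlast : G.detourLevel (u (Fin.last m)) = G.detourXi) :
    ∃ c : V → ℕ, c (u 0) = 0 ∧
      (∀ i : Fin m, (c (u i.succ) : ℤ) = c (u i.castSucc) + (m + 1) - G.detourOmega
        - G.detourLevel (u i.succ) - G.detourLevel (u i.castSucc)) ∧
      G.IsHamiltonianColoring c ∧ (coloringValue c : ℤ) = G.hcLowerBound ∧
      (2 ≤ m → StrictMono fun i => c (u i)) := by
  -- The smallest admissible gap. The subtraction does not truncate: an index in `Fin m` forces `m ≥
  -- 1`, so `2 * D ≤ m + 1` gives `D ≤ m`.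
  let d : Fin m → ℕ := fun i => m - G.detourDist (u i.castSucc) (u i.succ)
  have hd : ∀ i : Fin m, d i + G.detourDist (u i.castSucc) (u i.succ) = m := fun i => by
    have h1 := hdiam (u i.castSucc) (u i.succ)
    have h2 := i.isLt
    simp only [d]
    omega
  let a : Fin (m + 1) → ℕ := Fin.partialSum d
  have ha0 : a 0 = 0 := Fin.partialSum_zero d
  have ha : ∀ i : Fin m, a i.succ = a i.castSucc + d i := Fin.partialSum_succ d
  have hmono : Monotone a := Fin.monotone_iff_le_succ.2 fun i => by rw [ha]; omega
  let c : V → ℕ := fun v => a (u.symm v)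
  have hc : ∀ i, c (u i) = a i := fun i => by simp [c]
  have hrec : ∀ i : Fin m, (c (u i.succ) : ℤ) = c (u i.castSucc) + (m + 1) - G.detourOmega
      - G.detourLevel (u i.succ) - G.detourLevel (u i.castSucc) := fun i => by
    have h1 := hd i
    have h2 := hstep i
    rw [hc, hc, ha]
    omega
  have hlt : ∀ i j, i < j → m + a i ≤ G.detourDist (u i) (u j) + a j := by
    intro i j hij
    obtain ⟨k, rfl⟩ := Fin.exists_castSucc_eq.2 (ne_of_lt (hij.trans_le (Fin.le_last j)))
    rcases (Fin.castSucc_lt_iff_succ_le.1 hij).eq_or_lt with rfl | hkj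
    · have h1 := hd k
      have h2 := ha k
      omega
    -- Nonconsecutive vertices: the first and last gaps between them sum to at least `2 * m - (m +
    -- 1) = m - 1`, and positivity of `D` gives the missing 1.
    · obtain ⟨k', hk'⟩ := Fin.exists_castSucc_eq.2 (ne_of_lt (hkj.trans_le (Fin.le_last j)))
      rw [← hk'] at hkj
      have h1 := hmono (Fin.castSucc_lt_iff_succ_le.1 hkj)
      have h2 := ha k
      have h3 := ha k'
      rw [hk'] at h3
      have h4 := hd k
      have h5 := hd k'
      have h6 := hdiam (u k.castSucc) (u k.succ)
      have h7 := hdiam (u k'.castSucc) (u k'.succ)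
      have h8 := detourDist_pos hG.1 (u.injective.ne hij.ne)
      omega
  refine ⟨c, by rw [hc, ha0], hrec, ?_, ?_, ?_⟩
  · intro v w hvw
    obtain ⟨i, rfl⟩ := u.surjective v
    obtain ⟨j, rfl⟩ := u.surjective w
    rw [hc, hc, hm]
    rcases lt_or_gt_of_ne (fun h : i = j => hvw (h ▸ rfl)) with h | h
    · have h1 := hlt i j h
      have h2 := neg_abs_le ((a i : ℤ) - a j)
      push_cast
      omega
    · have h1 := hlt j i h
      have h2 := le_abs_self ((a i : ℤ) - a j)
      rw [detourDist_comm hG.1] at h1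
      push_cast
      omega
  · have h1 : coloringValue c = c (u (Fin.last m)) := by
      refine le_antisymm (Finset.sup_le fun v _ => ?_) (Finset.le_sup (Finset.mem_univ _))
      rw [hc]
      exact hmono (Fin.le_last _)
    have h2 := telescope_eq (fun i => (c (u i) : ℤ)) (fun i => (G.detourLevel (u i) : ℤ))
      ((m : ℤ) + 1 - G.detourOmega) fun i => by
        rw [hrec i]
        ring
    have h3 : (∑ i, (G.detourLevel (u i) : ℤ)) = G.totalDetourLevel := by
      rw [totalDetourLevel, Nat.cast_sum]
      exact u.sum_comp fun v => (G.detourLevel v : ℤ)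
    rw [h1, h2, h3, hc, ha0, h0, hlast, hcLowerBound, hm]
    push_cast
    ring
  -- For `m = 1` the only gap is `1 - 1 = 0`; from `m = 2` on, `2 * D ≤ m + 1` forces `D < m`.
  · intro h2m
    refine Fin.strictMono_iff_lt_succ.2 fun i => ?_
    have h1 := hd i
    have h2 := hdiam (u i.castSucc) (u i.succ)
    rw [hc, hc, ha]
    omega

theorem IsBlockGraph.hamiltonianChromaticNumber_of_ordering (hG : G.IsBlockGraph)
    {u : Fin (Fintype.card V) ≃ V} (hend : G.EndLevelCondition u) (hbr : G.BranchCondition u)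
    (hD : (G.detourDiam : ℚ) ≤ (Fintype.card V : ℚ) / 2) :
    (G.hamiltonianChromaticNumber : ℤ) = G.hcLowerBound ∧
      ∃ c : V → ℕ, G.IsOrderingColoring u c ∧ G.IsOptimalHamiltonianColoring c ∧
        (3 ≤ Fintype.card V → StrictMono fun i => c (u i)) := by
  have := hG.1.nonempty
  have hω := G.one_le_detourOmega
  obtain ⟨m, hm⟩ := Nat.exists_eq_succ_of_ne_zero (Fintype.card_ne_zero (α := V))
  have hdiam : ∀ a b, 2 * G.detourDist a b ≤ m + 1 := fun a b => by
    have h1 : G.detourDist a b ≤ G.detourDiam :=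
      Finset.le_sup (f := fun p : V × V => G.detourDist p.1 p.2) (Finset.mem_univ (a, b))
    rw [le_div_iff₀ (by norm_num)] at hD
    have h2 : G.detourDiam * 2 ≤ Fintype.card V := by exact_mod_cast hD
    omega
  let u' : Fin (m + 1) ≃ V := (finCongr hm.symm).trans u
  have hu' : ∀ (i : Fin (Fintype.card V)) (j : Fin (m + 1)), i.val = j.val → u i = u' j :=
    fun i j h => congrArg u (Fin.ext h)
  obtain ⟨c, hc0, hcs, hham, hval, hstrict⟩ := hG.exists_coloring_of_ordering hm u' hdiam
    (fun i => by
      have h1 := hbr (finCongr hm.symm i.castSucc) (finCongr hm.symm i.succ) (by simp)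
      rcases hω.eq_or_lt with h | h
      · exact hG.detourDist_of_inDifferentBranches h.symm (h1.1 h.symm)
      · exact hG.detourDist_of_inOppositeBranches (h1.2 h))
    (hend.1 (finCongr hm.symm 0) (by simp))
    (by
      have h1 := hend.2 (finCongr hm.symm (Fin.last m)) (by simp [hm])
      rcases hω.eq_or_lt with h | h
      · exact h1.1 h.symm
      · rw [detourXi, if_neg h.ne']
        exact h1.2 h)
  have hopt := hG.isOptimal_of_coloringValue_eq hham hval
  refine ⟨by rw [← hopt.2, hval], c, ⟨fun i hi => ?_, fun i j hij => ?_⟩, hopt, fun h3 => ?_⟩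
  · rw [hu' i 0 (by simpa using hi), hc0]
  · have hlt : i.val < m := by have := j.isLt; omega
    rw [hu' i (Fin.castSucc ⟨i, hlt⟩) rfl, hu' j (Fin.succ ⟨i, hlt⟩) (by simpa using hij),
      hcs]
    have hm' : (Fintype.card V : ℤ) = m + 1 := by exact_mod_cast hm
    linarith
  · exact fun i j hij => hstrict (by omega) (a := finCongr hm i) (b := finCongr hm j) hij

end SimpleGraph

theorem theorem4 {V : Type*} [Fintype V] (G : SimpleGraph V) (hG : G.IsBlockGraph) :
    (∀ u : Fin (Fintype.card V) ≃ V,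
      G.EndLevelCondition u → G.BranchCondition u →
      (G.detourDiam : ℚ) ≤ (Fintype.card V : ℚ) / 2 →
        (G.hamiltonianChromaticNumber : ℤ) = G.hcLowerBound ∧
        ∃ c : V → ℕ, G.IsOrderingColoring u c ∧ G.IsOptimalHamiltonianColoring c ∧
          (3 ≤ Fintype.card V → StrictMono fun i => c (u i))) ∧
    (G.IsSDBHalf → (G.hamiltonianChromaticNumber : ℤ) = G.hcLowerBound) := by
  refine ⟨fun u hend hbr hD => hG.hamiltonianChromaticNumber_of_ordering hend hbr hD, ?_⟩
  rintro ⟨-, ⟨u, hend, hbr⟩, hD⟩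
  exact (hG.hamiltonianChromaticNumber_of_ordering hend hbr hD).1
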